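/- **Definitions.** A *poset-enriched symmetric monoidal category* is a symmetric monoidal category whose homsets are posets and whose composition $;$ and monoidal product $\otimes$ of arrows are monotone. A *cartesian bicategory* is a poset-enriched symmetric monoidal category $(\mathcal C,\otimes,I)$ in which every object $X$ carries a commutative comonoid $(\Delta_X\colon X\to X\otimes X,\ \varepsilon_X\colon X\to I)$ and a commutative monoid $(\nabla_X\colon X\otimes X\to X,\ \eta_X\colon I\to X)$, both coherent with $\otimes$ and $I$, such that: every arrow $c\colon X\to Y$ is a lax comonoid homomorphism, $c;\Delta_Y\le\Delta_X;(c\otimes c)$ and $c;\varepsilon_Y\le\varepsilon_X$; the comonoids are left adjoint to the monoids, $\mathrm{id}_X\le\Delta_X;\nabla_X$, $\nabla_X;\Delta_X\le\mathrm{id}_{X\otimes X}$, $\mathrm{id}_X\le\varepsilon_X;\eta_X$, $\eta_X;\varepsilon_X\le\mathrm{id}_I$; and the special Frobenius laws hold, $\Delta_X;\nabla_X=\mathrm{id}_X$ and (suppressing associators) $(\Delta_X\otimes\mathrm{id}_X);(\mathrm{id}_X\otimes\nabla_X)=(\mathrm{id}_X\otimes\Delta_X);(\nabla_X\otimes\mathrm{id}_X)$.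 An arrow $f\colon X\to Y$ is a *map* if moreover $\Delta_X;(f\otimes f)\le f;\Delta_Y$ and $\varepsilon_X\le f;\varepsilon_Y$. A *peircean bicategory* is a cartesian bicategory whose homsets, with their given order, are Boolean algebras, such that $f;\neg c=\neg(f;c)$ for all maps $f\colon X\to Y$ and all arrows $c\colon Y\to Z$. Let $\mathcal C$ be a category with finite products, with terminal object $1$. A *boolean hyperdoctrine* on $\mathcal C$ is a functor $P\colon\mathcal C^{\mathrm{op}}\to\mathbf{BoolAlg}$, $f\mapsto P_f$, such that * for every $Y$ there is $\delta_Y\in P(Y\times Y)$ such that, for every $X$, the assignment $\alpha\mapsto P_{\langle\pi_1,\pi_2\rangle}(\alpha)\wedge P_{\langle\pi_2,\pi_3\rangle}(\delta_Y)$ is left adjoint to $P_{\mathrm{id}_X\times\langle\mathrm{id}_Y,\mathrm{id}_Y\rangle}\colon P(X\times Y\times Y)\to P(X\times Y)$; * for every projection $\pi_X\colon X\times Y\to X$, $P_{\pi_X}$ has a left adjoint $\exists_{\pi_X}$, and these satisfy the Beck–Chevalley condition $P_f\,\exists_{\pi_X}=\exists_{\pi_{X'}}P_{f\times\mathrm{id}_Y}$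 for all $f\colon X'\to X$ and Frobenius reciprocity $\exists_{\pi_X}(P_{\pi_X}(\alpha)\wedge\beta)=\alpha\wedge\exists_{\pi_X}(\beta)$. The *bicategory of relations* $\mathsf{Rel}(P)$ has the objects of $\mathcal C$; its homset from $X$ to $Y$ is the Boolean algebra $P(X\times Y)$; the identity of $X$ is $\delta_X$; the composite of $\varphi\in P(X\times Y)$ and $\psi\in P(Y\times Z)$ is $\exists_{\pi_{X\times Z}}(P_{\pi_{X\times Y}}(\varphi)\wedge P_{\pi_{Y\times Z}}(\psi))$; on objects $X\otimes Y=X\times Y$ and $I=1$, and for $\varphi\in P(X\times Y)$, $\psi\in P(U\times V)$, $\varphi\otimes\psi=P_{\langle\pi_X,\pi_Y\rangle}(\varphi)\wedge P_{\langle\pi_U,\pi_V\rangle}(\psi)\in P((X\times U)\times(Y\times V))$. Writing $\Gamma(f)=P_{f\times\mathrm{id}_Y}(\delta_Y)\in P(X\times Y)$ for the graph of $f\colon X\to Y$, the associators, unitors and symmetries are the graphs of those of $\mathcal C$, $\Delta_X=\Gamma(\langle\mathrm{id}_X,\mathrm{id}_X\rangle)$, $\varepsilon_X=\Gamma(!_X)$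 with $!_X\colon X\to 1$, $\nabla_X=P_{\mathrm{id}_{X\times X}\times\langle\mathrm{id}_X,\mathrm{id}_X\rangle}(\delta_{X\times X})$ and $\eta_X=P_{\mathrm{id}_1\times !_X}(\delta_1)$. **Proposition.** Let $P$ be a boolean hyperdoctrine. Then $\mathsf{Rel}(P)$, with this structure, is a peircean bicategory. In particular, its homsets $P(X\times Y)$ are Boolean algebras, and $\varphi;\neg\psi=\neg(\varphi;\psi)$ for every map $\varphi\in P(X\times Y)$ and every $\psi\in P(Y\times Z)$. -/

import Mathlib

open CategoryTheory MonoidalCategory CartesianMonoidalCategory Opposite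
open scoped MonObj ComonObj

attribute [-instance] CategoryTheory.catToReflQuiver

universe u v w

/-! ### Cartesian and peircean bicategories -/

/-- A cartesian bicategory ("of relations"): a poset-enriched symmetric monoidal category in which
every object carries a coherent commutative comonoid `(Δ, ε)` (this part, with the symmetry, is
`CopyDiscardCategory`) and a coherent commutative monoid `(μ, η)`, such that all arrows are lax
comonoid homomorphisms, the comonoids are left adjoint to the monoids, and the special Frobenius
laws hold. The posets are a parameter, so that they can also come from Boolean algebras. -/
class CartesianBicategory (C : Type u) [Category.{w} C] [MonoidalCategory C]
    [∀ X Y : C, PartialOrder (X ⟶ Y)] extends CopyDiscardCategory C where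
  comp_mono {X Y Z : C} {c c' : X ⟶ Y} {d d' : Y ⟶ Z} : c ≤ c' → d ≤ d' → c ≫ d ≤ c' ≫ d'
  tensor_mono {X Y U V : C} {c c' : X ⟶ Y} {d d' : U ⟶ V} :
    c ≤ c' → d ≤ d' → (c ⊗ₘ d) ≤ (c' ⊗ₘ d')
  /-- Every object carries a monoid structure ... -/
  [monObj : (X : C) → MonObj X]
  /-- ... which is commutative. -/
  [isCommMonObj : (X : C) → IsCommMonObj X]
  -- coherence of the monoids with the monoidal product and the unit
  mul_tensor (X Y : C) : (monObj (X ⊗ Y)).mul =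
    tensorμ X Y X Y ≫ ((monObj X).mul ⊗ₘ (monObj Y).mul)
  one_tensor (X Y : C) : (monObj (X ⊗ Y)).one =
    (λ_ (𝟙_ C)).inv ≫ ((monObj X).one ⊗ₘ (monObj Y).one)
  mul_unit : (monObj (𝟙_ C)).mul = (λ_ (𝟙_ C)).hom
  one_unit : (monObj (𝟙_ C)).one = 𝟙 (𝟙_ C)
  -- every arrow is a lax comonoid homomorphism
  copy_lax {X Y : C} (c : X ⟶ Y) : c ≫ Δ[Y] ≤ Δ[X] ≫ (c ⊗ₘ c)
  discard_lax {X Y : C} (c : X ⟶ Y) : c ≫ ε[Y] ≤ ε[X]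
  -- the comonoids are left adjoint to the monoids
  copy_unit_le (X : C) : 𝟙 X ≤ Δ[X] ≫ μ[X]
  copy_counit_le (X : C) : μ[X] ≫ Δ[X] ≤ 𝟙 (X ⊗ X)
  discard_unit_le (X : C) : 𝟙 X ≤ ε[X] ≫ η[X]
  discard_counit_le (X : C) : η[X] ≫ ε[X] ≤ 𝟙 (𝟙_ C)
  -- special Frobenius bimonoids
  special (X : C) : Δ[X] ≫ μ[X] = 𝟙 X
  frobenius (X : C) : (Δ[X] ▷ X) ≫ (α_ X X X).hom ≫ (X ◁ μ[X]) =
    (X ◁ Δ[X]) ≫ (α_ X X X).inv ≫ (μ[X] ▷ X)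

/-- A map of a cartesian bicategory: an arrow that satisfies the inequalities opposite to those of
a lax comonoid homomorphism. -/
def CartesianBicategory.IsMap {C : Type u} [Category.{w} C] [MonoidalCategory C]
    [∀ X Y : C, PartialOrder (X ⟶ Y)] [CartesianBicategory C] {X Y : C} (f : X ⟶ Y) : Prop :=
  Δ[X] ≫ (f ⊗ₘ f) ≤ f ≫ Δ[Y] ∧ ε[X] ≤ f ≫ ε[Y]

/-- The raw data of a peircean bicategory, without any axiom apart from those of the Boolean
algebras on the homsets. Inverses of the structural isomorphisms and whiskerings are omitted, since
the axioms determine them. -/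
structure PeirceanData where
  Obj : Type u
  Hom : Obj → Obj → Type w
  boolean : ∀ X Y, BooleanAlgebra (Hom X Y)
  id : ∀ X, Hom X X
  comp : ∀ {X Y Z}, Hom X Y → Hom Y Z → Hom X Z
  tensorObj : Obj → Obj → Obj
  tensorUnit : Obj
  tensorHom : ∀ {X Y U V}, Hom X Y → Hom U V → Hom (tensorObj X U) (tensorObj Y V)
  associator : ∀ X Y Z, Hom (tensorObj (tensorObj X Y) Z) (tensorObj X (tensorObj Y Z))
  leftUnitor : ∀ X, Hom (tensorObj tensorUnit X) X
  rightUnitor : ∀ X, Hom (tensorObj X tensorUnit) X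
  symmetry : ∀ X Y, Hom (tensorObj X Y) (tensorObj Y X)
  copy : ∀ X, Hom X (tensorObj X X)
  discard : ∀ X, Hom X tensorUnit
  cocopy : ∀ X, Hom (tensorObj X X) X
  codiscard : ∀ X, Hom tensorUnit X

/-- A peircean bicategory: a cartesian bicategory whose homsets, with their given order, are
Boolean algebras, such that precomposition with a map commutes with negation. -/
structure PeirceanBicategory where
  Obj : Type u
  [category : Category.{w} Obj]
  [monoidal : MonoidalCategory Obj]
  [boolean : ∀ X Y : Obj, BooleanAlgebra (X ⟶ Y)]
  [cartesian : CartesianBicategory Obj]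
  map_comp_compl : ∀ {X Y Z : Obj} (f : X ⟶ Y) (c : Y ⟶ Z),
    CartesianBicategory.IsMap f → f ≫ cᶜ = (f ≫ c)ᶜ

attribute [instance] PeirceanBicategory.category PeirceanBicategory.monoidal
  PeirceanBicategory.boolean PeirceanBicategory.cartesian

/-- The raw data underlying a peircean bicategory. -/
def PeirceanBicategory.toData (B : PeirceanBicategory.{u, w}) : PeirceanData.{u, w} where
  Obj := B.Obj
  Hom X Y := X ⟶ Y
  boolean X Y := B.boolean X Y
  id X := 𝟙 X
  comp c d := c ≫ d
  tensorObj X Y := X ⊗ Y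
  tensorUnit := 𝟙_ B.Obj
  tensorHom c d := c ⊗ₘ d
  associator X Y Z := (α_ X Y Z).hom
  leftUnitor X := (λ_ X).hom
  rightUnitor X := (ρ_ X).hom
  symmetry X Y := (β_ X Y).hom
  copy X := (CopyDiscardCategory.comonObj X).comul
  discard X := (CopyDiscardCategory.comonObj X).counit
  cocopy X := (CartesianBicategory.monObj X).mul
  codiscard X := (CartesianBicategory.monObj X).one

/-- The given raw data are those of a peircean bicategory, i.e. they satisfy all its axioms. -/
def PeirceanData.IsPeirceanBicategory (D : PeirceanData.{u, w}) : Prop :=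
  ∃ B : PeirceanBicategory.{u, w}, B.toData = D

/-! ### Boolean hyperdoctrines -/

/-- Reindexing `P_f : P(Y) → P(X)` along `f : X ⟶ Y`. -/
def reindex {C : Type u} [Category.{v} C] (P : Cᵒᵖ ⥤ BoolAlg.{w}) {X Y : C} (f : X ⟶ Y)
    (α : P.obj (op Y)) : P.obj (op X) :=
  (P.map f.op).hom α

/-- A boolean hyperdoctrine on a category `C` with finite products: a functor from `Cᵒᵖ` to Boolean
algebras that is an elementary and existential doctrine. The equality predicates `δ` and the left
adjoints `ex` are uniquely determined by their laws. -/
structure BooleanHyperdoctrine (C : Type u) [Category.{v} C] [CartesianMonoidalCategory C] where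
  P : Cᵒᵖ ⥤ BoolAlg.{w}
  /-- The equality predicate on `Y`. -/
  δ (Y : C) : P.obj (op (Y ⊗ Y))
  /-- `α ↦ P_⟨π₁,π₂⟩(α) ∧ P_⟨π₂,π₃⟩(δ_Y)` is left adjoint to `P_{id × Δ_Y}`, where
  `id × Δ_Y : X × Y ⟶ X × Y × Y`. -/
  eq_adj (X Y : C) : GaloisConnection
    (fun α : P.obj (op (X ⊗ Y)) =>
      reindex P (X ◁ fst Y Y : X ⊗ (Y ⊗ Y) ⟶ X ⊗ Y) α ⊓
        reindex P (snd X (Y ⊗ Y) : X ⊗ (Y ⊗ Y) ⟶ Y ⊗ Y) (δ Y))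
    (reindex P (X ◁ lift (𝟙 Y) (𝟙 Y) : X ⊗ Y ⟶ X ⊗ (Y ⊗ Y)))
  /-- Existential quantification along the projection `X × Y ⟶ X`. -/
  ex (X Y : C) : P.obj (op (X ⊗ Y)) → P.obj (op X)
  ex_adj (X Y : C) : GaloisConnection (ex X Y) (reindex P (fst X Y))
  beck_chevalley {X X' : C} (f : X' ⟶ X) (Y : C) (α : P.obj (op (X ⊗ Y))) :
    reindex P f (ex X Y α) = ex X' Y (reindex P (f ▷ Y) α)
  frobenius (X Y : C) (α : P.obj (op X)) (β : P.obj (op (X ⊗ Y))) :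
    ex X Y (reindex P (fst X Y) α ⊓ β) = α ⊓ ex X Y β

namespace BooleanHyperdoctrine

variable {C : Type u} [Category.{v} C] [CartesianMonoidalCategory C]
  (D : BooleanHyperdoctrine.{u, v, w} C)

/-- The graph `P_{f × id_Y}(δ_Y) ∈ P(X × Y)` of an arrow `f : X ⟶ Y`. -/
def graph {X Y : C} (f : X ⟶ Y) : D.P.obj (op (X ⊗ Y)) :=
  reindex D.P (f ▷ Y) (D.δ Y)

/-- The converse `P_{id_Y × f}(δ_Y) ∈ P(Y × X)` of the graph of `f : X ⟶ Y`. -/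
def cograph {X Y : C} (f : X ⟶ Y) : D.P.obj (op (Y ⊗ X)) :=
  reindex D.P (Y ◁ f) (D.δ Y)

/-- Relational composition `∃_{π_{X×Z}}(P_{π_{X×Y}}(φ) ∧ P_{π_{Y×Z}}(ψ))`. The product of `X`, `Y`
and `Z` is taken in the form `(X × Z) × Y`, so that `π_{X×Z}` is a first projection. -/
def relComp {X Y Z : C} (φ : D.P.obj (op (X ⊗ Y))) (ψ : D.P.obj (op (Y ⊗ Z))) :
    D.P.obj (op (X ⊗ Z)) :=
  D.ex (X ⊗ Z) Y
    (reindex D.P (lift (fst (X ⊗ Z) Y ≫ fst X Z) (snd (X ⊗ Z) Y)) φ ⊓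
      reindex D.P (lift (snd (X ⊗ Z) Y) (fst (X ⊗ Z) Y ≫ snd X Z)) ψ)

/-- Monoidal product `P_⟨π_X,π_Y⟩(φ) ∧ P_⟨π_U,π_V⟩(ψ) ∈ P((X × U) × (Y × V))` of relations. -/
def relTensor {X Y U V : C} (φ : D.P.obj (op (X ⊗ Y))) (ψ : D.P.obj (op (U ⊗ V))) :
    D.P.obj (op ((X ⊗ U) ⊗ (Y ⊗ V))) :=
  reindex D.P (lift (fst (X ⊗ U) (Y ⊗ V) ≫ fst X U) (snd (X ⊗ U) (Y ⊗ V) ≫ fst Y V)) φ ⊓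
    reindex D.P (lift (fst (X ⊗ U) (Y ⊗ V) ≫ snd X U) (snd (X ⊗ U) (Y ⊗ V) ≫ snd Y V)) ψ

/-- The data of the bicategory of relations `Rel(P)`: its objects are those of `C` and its arrows
`X → Y` are the elements of the Boolean algebra `P(X × Y)`; the structural isomorphisms and the
comonoids are graphs of those of `C`, and the monoids are converses of graphs. -/
def rel : PeirceanData.{u, w} where
  Obj := C
  Hom X Y := D.P.obj (op (X ⊗ Y))
  boolean X Y := (D.P.obj (op (X ⊗ Y))).str
  id X := D.δ X
  comp φ ψ := D.relComp φ ψ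
  tensorObj X Y := X ⊗ Y
  tensorUnit := 𝟙_ C
  tensorHom φ ψ := D.relTensor φ ψ
  associator X Y Z := D.graph (α_ X Y Z).hom
  leftUnitor X := D.graph (λ_ X).hom
  rightUnitor X := D.graph (ρ_ X).hom
  symmetry X Y := D.graph (lift (snd X Y) (fst X Y))
  copy X := D.graph (lift (𝟙 X) (𝟙 X))
  discard X := D.graph (toUnit X)
  cocopy X := D.cograph (lift (𝟙 X) (𝟙 X))
  codiscard X := D.cograph (toUnit X)

end BooleanHyperdoctrine

-- The proof argues in the internal logic of `P`. A relation is evaluated at generalized elements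
-- (`ev`), and inequalities of relations may be tested there (`le_of_ev_le`). In this reading `δ` is
-- a reflexive, substitutive equality, componentwise on products (`ev_δ_self`,
-- `ev_inf_ev_δ_le_right`, `ev_δ_tensor`). Composition is an existential quantifier with an
-- introduction rule `le_ev_relComp` and an elimination rule `inf_ev_relComp_le`.
--
-- Composing with a graph on the left, or with a converse of a graph on the right, is mere
-- substitution (`ev_graph_relComp`, `ev_relComp_cograph`). Hence graphs are functorial, their
-- converses contravariantly so, and both respect products. The coherence, comonoid and monoid laws
-- thereby reduce to identities between arrows of `C`; the remaining bicategory axioms are short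
-- arguments about equality.
--
-- A map is a single-valued and total relation. Single-valuedness gives `φ;¬ψ ≤ ¬(φ;ψ)`, and
-- totality with excluded middle gives the converse.

attribute [-simp] op_tensorObj op_tensorUnit

/-! ### Reindexing as a functorial Boolean homomorphism -/

section Reindex

variable {C : Type u} [Category.{v} C] (P : Cᵒᵖ ⥤ BoolAlg.{w}) {X Y Z : C}

theorem reindex_id (α : P.obj (op X)) : reindex P (𝟙 X) α = α := by
  simp [reindex]

theorem reindex_reindex (f : X ⟶ Y) (g : Y ⟶ Z) (α : P.obj (op Z)) :
    reindex P f (reindex P g α) = reindex P (f ≫ g) α := by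
  simp [reindex]

theorem reindex_inf (f : X ⟶ Y) (α β : P.obj (op Y)) :
    reindex P f (α ⊓ β) = reindex P f α ⊓ reindex P f β :=
  map_inf (P.map f.op).hom α β

theorem reindex_sup (f : X ⟶ Y) (α β : P.obj (op Y)) :
    reindex P f (α ⊔ β) = reindex P f α ⊔ reindex P f β :=
  map_sup (P.map f.op).hom α β

theorem reindex_top (f : X ⟶ Y) : reindex P f (⊤ : P.obj (op Y)) = ⊤ :=
  map_top (P.map f.op).hom

theorem reindex_bot (f : X ⟶ Y) : reindex P f (⊥ : P.obj (op Y)) = ⊥ :=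
  map_bot (P.map f.op).hom

theorem reindex_compl (f : X ⟶ Y) (α : P.obj (op Y)) :
    reindex P f αᶜ = (reindex P f α)ᶜ :=
  map_compl' (P.map f.op).hom α

theorem reindex_mono (f : X ⟶ Y) {α β : P.obj (op Y)} (h : α ≤ β) :
    reindex P f α ≤ reindex P f β :=
  OrderHomClass.mono (P.map f.op).hom h

end Reindex

namespace BooleanHyperdoctrine

variable {C : Type u} [Category.{v} C] [CartesianMonoidalCategory C]
  (D : BooleanHyperdoctrine.{u, v, w} C)

/-! ### Relations at generalized elements -/

/-- The relation `φ ∈ P(X × Y)` at the generalized elements `x` and `y`, a predicate on their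
common stage. -/
def ev {A X Y : C} (φ : D.P.obj (op (X ⊗ Y))) (x : A ⟶ X) (y : A ⟶ Y) : D.P.obj (op A) :=
  reindex D.P (lift x y) φ

section Evaluation

variable {A B X Y Z U V W : C}

theorem reindex_ev (g : B ⟶ A) (φ : D.P.obj (op (X ⊗ Y))) (x : A ⟶ X) (y : A ⟶ Y) :
    reindex D.P g (D.ev φ x y) = D.ev φ (g ≫ x) (g ≫ y) := by
  simp [ev, reindex_reindex]

theorem ev_fst_snd (φ : D.P.obj (op (X ⊗ Y))) : D.ev φ (fst X Y) (snd X Y) = φ := by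
  simp [ev, reindex_id]

variable {D} in
-- As in the Yoneda lemma, the generic pair of projections already decides the inequality.
theorem le_of_ev_le {φ ψ : D.P.obj (op (X ⊗ Y))}
    (h : ∀ (A : C) (x : A ⟶ X) (y : A ⟶ Y), D.ev φ x y ≤ D.ev ψ x y) : φ ≤ ψ := by
  simpa only [ev_fst_snd] using h _ (fst X Y) (snd X Y)

variable {D} in
theorem eq_of_ev_eq {φ ψ : D.P.obj (op (X ⊗ Y))}
    (h : ∀ (A : C) (x : A ⟶ X) (y : A ⟶ Y), D.ev φ x y = D.ev ψ x y) : φ = ψ := by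
  simpa only [ev_fst_snd] using h _ (fst X Y) (snd X Y)

theorem ev_mono {φ ψ : D.P.obj (op (X ⊗ Y))} (h : φ ≤ ψ) (x : A ⟶ X) (y : A ⟶ Y) :
    D.ev φ x y ≤ D.ev ψ x y :=
  reindex_mono _ _ h

theorem ev_compl (φ : D.P.obj (op (X ⊗ Y))) (x : A ⟶ X) (y : A ⟶ Y) :
    D.ev φᶜ x y = (D.ev φ x y)ᶜ :=
  reindex_compl _ _ _

theorem ev_top (x : A ⟶ X) (y : A ⟶ Y) : D.ev (⊤ : D.P.obj (op (X ⊗ Y))) x y = ⊤ :=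
  reindex_top _ _

theorem ev_graph (f : X ⟶ Y) (x : A ⟶ X) (y : A ⟶ Y) :
    D.ev (D.graph f) x y = D.ev (D.δ Y) (x ≫ f) y := by
  simp [ev, graph, reindex_reindex]

theorem ev_cograph (f : X ⟶ Y) (y : A ⟶ Y) (x : A ⟶ X) :
    D.ev (D.cograph f) y x = D.ev (D.δ Y) y (x ≫ f) := by
  simp [ev, cograph, reindex_reindex]

theorem ev_relTensor (φ : D.P.obj (op (X ⊗ Y))) (ψ : D.P.obj (op (U ⊗ V)))
    (p : A ⟶ X ⊗ U) (q : A ⟶ Y ⊗ V) :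
    D.ev (D.relTensor φ ψ) p q =
      D.ev φ (p ≫ fst X U) (q ≫ fst Y V) ⊓ D.ev ψ (p ≫ snd X U) (q ≫ snd Y V) := by
  simp [ev, relTensor, reindex_reindex, reindex_inf]

theorem graph_id (X : C) : D.graph (𝟙 X) = D.δ X := by
  simp [graph, reindex_id]

theorem cograph_id (X : C) : D.cograph (𝟙 X) = D.δ X := by
  simp [cograph, reindex_id]

/-! ### Equality -/

theorem ev_δ_self (x : A ⟶ X) : D.ev (D.δ X) x x = ⊤ := by
  have h := (D.eq_adj A X).le_u_l ⊤
  have h' := reindex_mono D.P (lift (𝟙 A) x) h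
  simpa [reindex_inf, reindex_top, reindex_reindex, ev] using h'

/-- Substitution of equals. -/
theorem ev_inf_ev_δ_le_right (φ : D.P.obj (op (X ⊗ Y))) (x : A ⟶ X) (y y' : A ⟶ Y) :
    D.ev φ x y ⊓ D.ev (D.δ Y) y y' ≤ D.ev φ x y' := by
  -- Here `b` is `φ(x, -)` read at the second copy of `Y`; on the diagonal it agrees with `a`, so
  -- the adjunction carries `a` to `b` along equality.
  have h := (D.eq_adj A Y).l_le (a := D.ev φ (fst A Y ≫ x) (snd A Y))
    (b := reindex D.P (A ◁ snd Y Y) (D.ev φ (fst A Y ≫ x) (snd A Y)))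
    (by simp [reindex_ev])
  have h' := reindex_mono D.P (lift (𝟙 A) (lift y y')) h
  simpa [reindex_inf, reindex_reindex, ev] using h'

/-- Substitute `x'` for `t` in the predicate `t = x`, which holds at `t = x`. -/
theorem ev_δ_symm_le (x x' : A ⟶ X) : D.ev (D.δ X) x x' ≤ D.ev (D.δ X) x' x := by
  have h := D.ev_inf_ev_δ_le_right (D.ev (D.δ X) (snd A X) (fst A X ≫ x)) (𝟙 A) x x'
  simpa [ev, reindex_reindex, show reindex D.P (lift x x) (D.δ X) = ⊤ from D.ev_δ_self x] using h

theorem ev_δ_comm (x x' : A ⟶ X) : D.ev (D.δ X) x x' = D.ev (D.δ X) x' x :=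
  le_antisymm (D.ev_δ_symm_le x x') (D.ev_δ_symm_le x' x)

theorem ev_inf_ev_δ_le_left (φ : D.P.obj (op (X ⊗ Y))) (x x' : A ⟶ X) (y : A ⟶ Y) :
    D.ev (D.δ X) x' x ⊓ D.ev φ x y ≤ D.ev φ x' y := by
  have h := D.ev_inf_ev_δ_le_right (D.ev φ (snd Y X) (fst Y X)) y x x'
  rw [ev_δ_comm, inf_comm]
  simpa [ev, reindex_reindex] using h

theorem ev_δ_le_ev_δ_comp (f : X ⟶ Y) (x x' : A ⟶ X) :
    D.ev (D.δ X) x x' ≤ D.ev (D.δ Y) (x ≫ f) (x' ≫ f) := by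
  have h := D.ev_inf_ev_δ_le_right (D.ev (D.δ Y) (fst A X ≫ x ≫ f) (snd A X ≫ f)) (𝟙 A) x x'
  have e : reindex D.P (lift (x ≫ f) (x ≫ f)) (D.δ Y) = ⊤ := D.ev_δ_self (x ≫ f)
  simpa [ev, reindex_reindex, e] using h

/-- Equality of pairs is componentwise. -/
theorem ev_δ_tensor (p q : A ⟶ X ⊗ Y) :
    D.ev (D.δ (X ⊗ Y)) p q =
      D.ev (D.δ X) (p ≫ fst X Y) (q ≫ fst X Y) ⊓ D.ev (D.δ Y) (p ≫ snd X Y) (q ≫ snd X Y) := by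
  apply le_antisymm
  · exact le_inf (D.ev_δ_le_ev_δ_comp _ p q) (D.ev_δ_le_ev_δ_comp _ p q)
  -- Starting from `p = p`, the components on the right are exchanged one at a time: `h₁` replaces
  -- the first, `h₂` the second.
  · have h₁ := D.ev_inf_ev_δ_le_right
      (D.ev (D.δ (X ⊗ Y)) (fst A X ≫ p) (lift (snd A X) (fst A X ≫ p ≫ snd X Y))) (𝟙 A)
      (p ≫ fst X Y) (q ≫ fst X Y)
    have h₂ := D.ev_inf_ev_δ_le_right
      (D.ev (D.δ (X ⊗ Y)) (fst A Y ≫ p) (lift (fst A Y ≫ q ≫ fst X Y) (snd A Y))) (𝟙 A)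
      (p ≫ snd X Y) (q ≫ snd X Y)
    have e : reindex D.P (lift p p) (D.δ (X ⊗ Y)) = ⊤ := D.ev_δ_self p
    simp [ev, reindex_reindex, e] at h₁ h₂ ⊢
    exact (inf_le_inf_right _ h₁).trans h₂

theorem ev_δ_unit (x y : A ⟶ 𝟙_ C) : D.ev (D.δ (𝟙_ C)) x y = ⊤ := by
  rw [toUnit_unique y x, ev_δ_self]

/-! ### Composition -/

/-- Beck–Chevalley lets substitution pass under the quantifier. -/
theorem ev_relComp (φ : D.P.obj (op (X ⊗ Y))) (ψ : D.P.obj (op (Y ⊗ Z)))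
    (x : A ⟶ X) (z : A ⟶ Z) :
    D.ev (D.relComp φ ψ) x z =
      D.ex A Y (D.ev φ (fst A Y ≫ x) (snd A Y) ⊓ D.ev ψ (snd A Y) (fst A Y ≫ z)) := by
  simp [ev, relComp, beck_chevalley, reindex_inf, reindex_reindex]

theorem ev_inf_ev_le_ev_relComp (φ : D.P.obj (op (X ⊗ Y))) (ψ : D.P.obj (op (Y ⊗ Z)))
    (x : A ⟶ X) (y : A ⟶ Y) (z : A ⟶ Z) :
    D.ev φ x y ⊓ D.ev ψ y z ≤ D.ev (D.relComp φ ψ) x z := by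
  have h := (D.ex_adj A Y).le_u_l (D.ev φ (fst A Y ≫ x) (snd A Y) ⊓ D.ev ψ (snd A Y) (fst A Y ≫ z))
  have h' := reindex_mono D.P (lift (𝟙 A) y) h
  rw [← ev_relComp] at h'
  simpa [reindex_inf, reindex_reindex, reindex_id, reindex_ev] using h'

variable {D}

theorem le_ev_relComp {κ : D.P.obj (op A)} {φ : D.P.obj (op (X ⊗ Y))} {ψ : D.P.obj (op (Y ⊗ Z))}
    {x : A ⟶ X} {z : A ⟶ Z} (y : A ⟶ Y) (h₁ : κ ≤ D.ev φ x y) (h₂ : κ ≤ D.ev ψ y z) :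
    κ ≤ D.ev (D.relComp φ ψ) x z :=
  (le_inf h₁ h₂).trans (D.ev_inf_ev_le_ev_relComp φ ψ x y z)

/-- To use that `x` and `z` are related by a composite, take an intermediate element. -/
theorem inf_ev_relComp_le {κ χ : D.P.obj (op A)} {φ : D.P.obj (op (X ⊗ Y))}
    {ψ : D.P.obj (op (Y ⊗ Z))} {x : A ⟶ X} {z : A ⟶ Z}
    (h : reindex D.P (fst A Y) κ ⊓
        (D.ev φ (fst A Y ≫ x) (snd A Y) ⊓ D.ev ψ (snd A Y) (fst A Y ≫ z)) ≤
      reindex D.P (fst A Y) χ) :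
    κ ⊓ D.ev (D.relComp φ ψ) x z ≤ χ := by
  -- Frobenius reciprocity moves the context `κ` under the quantifier.
  rw [ev_relComp, ← frobenius]
  exact (D.ex_adj A Y).l_le h

theorem ev_relComp_le {χ : D.P.obj (op A)} {φ : D.P.obj (op (X ⊗ Y))}
    {ψ : D.P.obj (op (Y ⊗ Z))} {x : A ⟶ X} {z : A ⟶ Z}
    (h : D.ev φ (fst A Y ≫ x) (snd A Y) ⊓ D.ev ψ (snd A Y) (fst A Y ≫ z) ≤
      reindex D.P (fst A Y) χ) :
    D.ev (D.relComp φ ψ) x z ≤ χ := by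
  rw [ev_relComp]
  exact (D.ex_adj A Y).l_le h

variable (D)

theorem ev_graph_relComp (f : X ⟶ Y) (ψ : D.P.obj (op (Y ⊗ Z))) (x : A ⟶ X) (z : A ⟶ Z) :
    D.ev (D.relComp (D.graph f) ψ) x z = D.ev ψ (x ≫ f) z := by
  apply le_antisymm
  · apply ev_relComp_le
    simpa only [ev_graph, reindex_ev, Category.assoc] using D.ev_inf_ev_δ_le_left ψ _ _ _
  · exact le_ev_relComp (x ≫ f) (by simp [ev_graph, ev_δ_self]) le_rfl

theorem ev_relComp_cograph (φ : D.P.obj (op (X ⊗ Y))) (g : Z ⟶ Y) (x : A ⟶ X) (z : A ⟶ Z) :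
    D.ev (D.relComp φ (D.cograph g)) x z = D.ev φ x (z ≫ g) := by
  apply le_antisymm
  · apply ev_relComp_le
    simpa only [ev_cograph, reindex_ev, Category.assoc] using D.ev_inf_ev_δ_le_right φ _ _ _
  · exact le_ev_relComp (z ≫ g) le_rfl (by simp [ev_cograph, ev_δ_self])

/-- `e(x) = y` iff `x = e⁻¹(y)`. Thus composing with the graph of an isomorphism on the right is
also a substitution. -/
theorem graph_hom_eq_cograph_inv (e : X ≅ Y) : D.graph e.hom = D.cograph e.inv := by
  refine eq_of_ev_eq fun A x y => ?_
  rw [ev_graph, ev_cograph]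
  apply le_antisymm
  · simpa using D.ev_δ_le_ev_δ_comp e.inv (x ≫ e.hom) y
  · simpa using D.ev_δ_le_ev_δ_comp e.hom x (y ≫ e.inv)

theorem ev_relComp_graph_hom (φ : D.P.obj (op (X ⊗ Y))) (e : Y ≅ Z) (x : A ⟶ X) (z : A ⟶ Z) :
    D.ev (D.relComp φ (D.graph e.hom)) x z = D.ev φ x (z ≫ e.inv) := by
  rw [graph_hom_eq_cograph_inv, ev_relComp_cograph]

theorem δ_relComp (φ : D.P.obj (op (X ⊗ Y))) : D.relComp (D.δ X) φ = φ :=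
  eq_of_ev_eq fun A x y => by rw [← graph_id, ev_graph_relComp, Category.comp_id]

theorem relComp_δ (φ : D.P.obj (op (X ⊗ Y))) : D.relComp φ (D.δ Y) = φ :=
  eq_of_ev_eq fun A x y => by rw [← cograph_id, ev_relComp_cograph, Category.comp_id]

theorem relComp_assoc (φ : D.P.obj (op (X ⊗ Y))) (ψ : D.P.obj (op (Y ⊗ Z)))
    (χ : D.P.obj (op (Z ⊗ W))) :
    D.relComp (D.relComp φ ψ) χ = D.relComp φ (D.relComp ψ χ) := by
  apply le_antisymm
  · refine le_of_ev_le fun A x w => ev_relComp_le ?_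
    -- The composite still to be opened is moved to the right. Afterwards the stage is `(A ⊗ Z) ⊗
    -- Y`, so `snd` is the element of `Y` and `fst ≫ snd` that of `Z`.
    rw [inf_comm]
    refine inf_ev_relComp_le ?_
    simp only [reindex_ev]
    refine le_ev_relComp (snd _ _) (inf_le_right.trans inf_le_left) ?_
    exact le_ev_relComp (fst _ _ ≫ snd _ _) (inf_le_right.trans inf_le_right) inf_le_left
  · refine le_of_ev_le fun A x w => ev_relComp_le ?_
    refine inf_ev_relComp_le ?_
    simp only [reindex_ev]
    refine le_ev_relComp (snd _ _) ?_ (inf_le_right.trans inf_le_right)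
    exact le_ev_relComp (fst _ _ ≫ snd _ _) inf_le_left (inf_le_right.trans inf_le_left)

variable {D} in
theorem relComp_mono {φ φ' : D.P.obj (op (X ⊗ Y))} {ψ ψ' : D.P.obj (op (Y ⊗ Z))}
    (h₁ : φ ≤ φ') (h₂ : ψ ≤ ψ') : D.relComp φ ψ ≤ D.relComp φ' ψ' := by
  refine le_of_ev_le fun A x z => ev_relComp_le ?_
  rw [reindex_ev]
  exact le_ev_relComp (snd _ _) (inf_le_left.trans (D.ev_mono h₁ _ _))
    (inf_le_right.trans (D.ev_mono h₂ _ _))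

variable {D} in
theorem relTensor_mono {φ φ' : D.P.obj (op (X ⊗ Y))} {ψ ψ' : D.P.obj (op (U ⊗ V))}
    (h₁ : φ ≤ φ') (h₂ : ψ ≤ ψ') : D.relTensor φ ψ ≤ D.relTensor φ' ψ' :=
  inf_le_inf (reindex_mono _ _ h₁) (reindex_mono _ _ h₂)

theorem relTensor_relComp_relTensor {X₁ X₂ Y₁ Y₂ Z₁ Z₂ : C}
    (φ₁ : D.P.obj (op (X₁ ⊗ Y₁))) (φ₂ : D.P.obj (op (X₂ ⊗ Y₂)))
    (ψ₁ : D.P.obj (op (Y₁ ⊗ Z₁))) (ψ₂ : D.P.obj (op (Y₂ ⊗ Z₂))) :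
    D.relComp (D.relTensor φ₁ φ₂) (D.relTensor ψ₁ ψ₂) =
      D.relTensor (D.relComp φ₁ ψ₁) (D.relComp φ₂ ψ₂) := by
  apply le_antisymm
  · refine le_of_ev_le fun A x z => ev_relComp_le ?_
    simp only [ev_relTensor, reindex_inf, reindex_ev, Category.assoc]
    refine le_inf (le_ev_relComp (snd _ _ ≫ fst _ _) ?_ ?_)
      (le_ev_relComp (snd _ _ ≫ snd _ _) ?_ ?_)
    exacts [inf_le_left.trans inf_le_left, inf_le_right.trans inf_le_left,
      inf_le_left.trans inf_le_right, inf_le_right.trans inf_le_right]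
  · refine le_of_ev_le fun A x z => ?_
    rw [ev_relTensor]
    refine inf_ev_relComp_le ?_
    rw [inf_comm, reindex_ev]
    refine inf_ev_relComp_le ?_
    simp only [reindex_ev, reindex_inf]
    -- The second composite was opened first, so its intermediate element is `fst ≫ snd`.
    refine le_ev_relComp (lift (snd _ _) (fst _ _ ≫ snd _ _)) ?_ ?_ <;>
      simp only [ev_relTensor, lift_fst, lift_snd, Category.assoc]
    · exact le_inf (inf_le_right.trans inf_le_left) (inf_le_left.trans inf_le_left)
    · exact le_inf (inf_le_right.trans inf_le_right) (inf_le_left.trans inf_le_right)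

/-! ### Graphs and converses of graphs -/

theorem graph_relComp_graph (f : X ⟶ Y) (g : Y ⟶ Z) :
    D.relComp (D.graph f) (D.graph g) = D.graph (f ≫ g) :=
  eq_of_ev_eq fun A x z => by simp [ev_graph_relComp, ev_graph]

theorem cograph_relComp_cograph (f : X ⟶ Y) (g : Y ⟶ Z) :
    D.relComp (D.cograph g) (D.cograph f) = D.cograph (f ≫ g) :=
  eq_of_ev_eq fun A x z => by simp [ev_relComp_cograph, ev_cograph]

theorem graph_relTensor_graph (f : X ⟶ Y) (g : U ⟶ V) :
    D.relTensor (D.graph f) (D.graph g) = D.graph (f ⊗ₘ g) :=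
  eq_of_ev_eq fun A x y => by simp [ev_relTensor, ev_graph, ev_δ_tensor]

theorem cograph_relTensor_cograph (f : X ⟶ Y) (g : U ⟶ V) :
    D.relTensor (D.cograph f) (D.cograph g) = D.cograph (f ⊗ₘ g) :=
  eq_of_ev_eq fun A x y => by simp [ev_relTensor, ev_cograph, ev_δ_tensor]

end Evaluation

section Structure

variable {X X' Y Y' Z Z' : C}

/-! ### The structural isomorphisms -/

theorem graph_iso_hom_inv (e : X ≅ Y) : D.relComp (D.graph e.hom) (D.graph e.inv) = D.δ X := by
  rw [graph_relComp_graph, e.hom_inv_id, graph_id]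

theorem graph_iso_inv_hom (e : X ≅ Y) : D.relComp (D.graph e.inv) (D.graph e.hom) = D.δ Y := by
  rw [graph_relComp_graph, e.inv_hom_id, graph_id]

theorem relTensor_δ_δ (X Y : C) : D.relTensor (D.δ X) (D.δ Y) = D.δ (X ⊗ Y) := by
  simp only [← graph_id, graph_relTensor_graph, id_tensorHom_id]

theorem graph_relTensor_δ (f : X ⟶ Y) (Z : C) :
    D.relTensor (D.graph f) (D.δ Z) = D.graph (f ▷ Z) := by
  simp only [← graph_id, graph_relTensor_graph, tensorHom_id]

theorem δ_relTensor_graph (Z : C) (f : X ⟶ Y) :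
    D.relTensor (D.δ Z) (D.graph f) = D.graph (Z ◁ f) := by
  simp only [← graph_id, graph_relTensor_graph, id_tensorHom]

theorem cograph_relTensor_δ (f : X ⟶ Y) (Z : C) :
    D.relTensor (D.cograph f) (D.δ Z) = D.cograph (f ▷ Z) := by
  simp only [← cograph_id, cograph_relTensor_cograph, tensorHom_id]

theorem δ_relTensor_cograph (Z : C) (f : X ⟶ Y) :
    D.relTensor (D.δ Z) (D.cograph f) = D.cograph (Z ◁ f) := by
  simp only [← cograph_id, cograph_relTensor_cograph, id_tensorHom]

theorem relTensor_relComp_associator (φ : D.P.obj (op (X ⊗ X'))) (ψ : D.P.obj (op (Y ⊗ Y')))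
    (χ : D.P.obj (op (Z ⊗ Z'))) :
    D.relComp (D.relTensor (D.relTensor φ ψ) χ) (D.graph (α_ X' Y' Z').hom) =
      D.relComp (D.graph (α_ X Y Z).hom) (D.relTensor φ (D.relTensor ψ χ)) :=
  eq_of_ev_eq fun A x y => by
    simp [ev_relComp_graph_hom, ev_graph_relComp, ev_relTensor, inf_assoc]

theorem relTensor_relComp_leftUnitor (φ : D.P.obj (op (X ⊗ Y))) :
    D.relComp (D.relTensor (D.δ (𝟙_ C)) φ) (D.graph (λ_ Y).hom) =
      D.relComp (D.graph (λ_ X).hom) φ :=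
  eq_of_ev_eq fun A x y => by
    rw [ev_relComp_graph_hom, ev_graph_relComp, ev_relTensor, ev_δ_unit]
    simp [leftUnitor_hom]

theorem relTensor_relComp_rightUnitor (φ : D.P.obj (op (X ⊗ Y))) :
    D.relComp (D.relTensor φ (D.δ (𝟙_ C))) (D.graph (ρ_ Y).hom) =
      D.relComp (D.graph (ρ_ X).hom) φ :=
  eq_of_ev_eq fun A x y => by
    rw [ev_relComp_graph_hom, ev_graph_relComp, ev_relTensor, ev_δ_unit]
    simp [rightUnitor_hom]

theorem graph_pentagon (W X Y Z : C) :
    D.relComp (D.relTensor (D.graph (α_ W X Y).hom) (D.δ Z))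
        (D.relComp (D.graph (α_ W (X ⊗ Y) Z).hom)
          (D.relTensor (D.δ W) (D.graph (α_ X Y Z).hom))) =
      D.relComp (D.graph (α_ (W ⊗ X) Y Z).hom) (D.graph (α_ W X (Y ⊗ Z)).hom) := by
  simp only [graph_relTensor_δ, δ_relTensor_graph, graph_relComp_graph, pentagon]

theorem graph_triangle (X Y : C) :
    D.relComp (D.graph (α_ X (𝟙_ C) Y).hom) (D.relTensor (D.δ X) (D.graph (λ_ Y).hom)) =
      D.relTensor (D.graph (ρ_ X).hom) (D.δ Y) := by
  simp only [graph_relTensor_δ, δ_relTensor_graph, graph_relComp_graph, triangle]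

/-- The symmetry of a category with finite products. -/
@[simps]
def swap (X Y : C) : X ⊗ Y ≅ Y ⊗ X where
  hom := lift (snd X Y) (fst X Y)
  inv := lift (snd Y X) (fst Y X)

theorem relTensor_relComp_swap (φ : D.P.obj (op (X ⊗ X'))) (ψ : D.P.obj (op (Y ⊗ Y'))) :
    D.relComp (D.relTensor φ ψ) (D.graph (swap X' Y').hom) =
      D.relComp (D.graph (swap X Y).hom) (D.relTensor ψ φ) :=
  eq_of_ev_eq fun A x y => by
    rw [ev_relComp_graph_hom, ev_graph_relComp]
    simp [ev_relTensor, inf_comm]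

theorem graph_hexagon_forward (X Y Z : C) :
    D.relComp (D.graph (α_ X Y Z).hom)
        (D.relComp (D.graph (swap X (Y ⊗ Z)).hom) (D.graph (α_ Y Z X).hom)) =
      D.relComp (D.relTensor (D.graph (swap X Y).hom) (D.δ Z))
        (D.relComp (D.graph (α_ Y X Z).hom) (D.relTensor (D.δ Y) (D.graph (swap X Z).hom))) := by
  simp only [graph_relTensor_δ, δ_relTensor_graph, graph_relComp_graph]
  congr 1
  ext <;> simp

theorem graph_hexagon_reverse (X Y Z : C) :
    D.relComp (D.graph (α_ X Y Z).inv)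
        (D.relComp (D.graph (swap (X ⊗ Y) Z).hom) (D.graph (α_ Z X Y).inv)) =
      D.relComp (D.relTensor (D.δ X) (D.graph (swap Y Z).hom))
        (D.relComp (D.graph (α_ X Z Y).inv) (D.relTensor (D.graph (swap X Z).hom) (D.δ Y))) := by
  simp only [graph_relTensor_δ, δ_relTensor_graph, graph_relComp_graph]
  congr 1
  ext <;> simp

/-- The exchange of the inner factors of a product of four objects. -/
@[simps]
def middleSwap (X Y U V : C) : (X ⊗ Y) ⊗ (U ⊗ V) ≅ (X ⊗ U) ⊗ (Y ⊗ V) where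
  hom := lift (fst X Y ⊗ₘ fst U V) (snd X Y ⊗ₘ snd U V)
  inv := lift (fst X U ⊗ₘ fst Y V) (snd X U ⊗ₘ snd Y V)

/-- The left-hand side is what `tensorμ` unfolds to in `Rel`; see `tensorμ_eq`. -/
theorem graph_middleSwap (X Y U V : C) :
    D.relComp (D.graph (α_ X Y (U ⊗ V)).hom)
      (D.relComp (D.relTensor (D.δ X) (D.graph (α_ Y U V).inv))
        (D.relComp (D.relTensor (D.δ X) (D.relTensor (D.graph (swap Y U).hom) (D.δ V)))
          (D.relComp (D.relTensor (D.δ X) (D.graph (α_ U Y V).hom))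
            (D.graph (α_ X U (Y ⊗ V)).inv)))) =
      D.graph (middleSwap X Y U V).hom := by
  simp only [graph_relTensor_δ, δ_relTensor_graph, graph_relComp_graph]
  congr 1
  ext <;> simp

/-! ### The comonoids -/

theorem graph_counit_comul (X : C) :
    D.relComp (D.graph (lift (𝟙 X) (𝟙 X))) (D.relTensor (D.graph (toUnit X)) (D.δ X)) =
      D.graph (λ_ X).inv := by
  simp only [graph_relTensor_δ, graph_relComp_graph]
  congr 1
  ext
  simp

theorem graph_comul_counit (X : C) :
    D.relComp (D.graph (lift (𝟙 X) (𝟙 X))) (D.relTensor (D.δ X) (D.graph (toUnit X))) =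
      D.graph (ρ_ X).inv := by
  simp only [δ_relTensor_graph, graph_relComp_graph]
  congr 1
  ext
  simp

theorem graph_comul_assoc (X : C) :
    D.relComp (D.graph (lift (𝟙 X) (𝟙 X)))
        (D.relTensor (D.δ X) (D.graph (lift (𝟙 X) (𝟙 X)))) =
      D.relComp (D.graph (lift (𝟙 X) (𝟙 X)))
        (D.relComp (D.relTensor (D.graph (lift (𝟙 X) (𝟙 X))) (D.δ X))
          (D.graph (α_ X X X).hom)) := by
  simp only [graph_relTensor_δ, δ_relTensor_graph, graph_relComp_graph]
  congr 1
  ext <;> simp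

theorem graph_comul_comm (X : C) :
    D.relComp (D.graph (lift (𝟙 X) (𝟙 X))) (D.graph (swap X X).hom) =
      D.graph (lift (𝟙 X) (𝟙 X)) := by
  rw [graph_relComp_graph]
  congr 1
  ext <;> simp

theorem graph_copy_tensor (X Y : C) :
    D.graph (lift (𝟙 (X ⊗ Y)) (𝟙 (X ⊗ Y))) =
      D.relComp (D.relTensor (D.graph (lift (𝟙 X) (𝟙 X))) (D.graph (lift (𝟙 Y) (𝟙 Y))))
        (D.graph (middleSwap X X Y Y).hom) := by
  rw [graph_relTensor_graph, graph_relComp_graph]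
  congr 1
  ext <;> simp

theorem graph_discard_tensor (X Y : C) :
    D.graph (toUnit (X ⊗ Y)) =
      D.relComp (D.relTensor (D.graph (toUnit X)) (D.graph (toUnit Y)))
        (D.graph (λ_ (𝟙_ C)).hom) := by
  rw [graph_relTensor_graph, graph_relComp_graph]
  congr 1
  exact toUnit_unique _ _

theorem graph_copy_unit : D.graph (lift (𝟙 (𝟙_ C)) (𝟙 (𝟙_ C))) = D.graph (λ_ (𝟙_ C)).inv := by
  congr 1
  ext

theorem graph_discard_unit : D.graph (toUnit (𝟙_ C)) = D.δ (𝟙_ C) := by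
  rw [toUnit_unit, graph_id]

/-! ### The monoids -/

/-- Once the unitor is a converse graph too, this is the counit law of the diagonal in `C`,
reversed. The other monoid laws follow the same pattern. -/
theorem cograph_one_mul (X : C) :
    D.relComp (D.relTensor (D.cograph (toUnit X)) (D.δ X)) (D.cograph (lift (𝟙 X) (𝟙 X))) =
      D.graph (λ_ X).hom := by
  rw [cograph_relTensor_δ, cograph_relComp_cograph, graph_hom_eq_cograph_inv]
  congr 1
  ext
  simp

theorem cograph_mul_one (X : C) :
    D.relComp (D.relTensor (D.δ X) (D.cograph (toUnit X))) (D.cograph (lift (𝟙 X) (𝟙 X))) =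
      D.graph (ρ_ X).hom := by
  rw [δ_relTensor_cograph, cograph_relComp_cograph, graph_hom_eq_cograph_inv]
  congr 1
  ext
  simp

theorem cograph_mul_assoc (X : C) :
    D.relComp (D.relTensor (D.cograph (lift (𝟙 X) (𝟙 X))) (D.δ X))
        (D.cograph (lift (𝟙 X) (𝟙 X))) =
      D.relComp (D.graph (α_ X X X).hom)
        (D.relComp (D.relTensor (D.δ X) (D.cograph (lift (𝟙 X) (𝟙 X))))
          (D.cograph (lift (𝟙 X) (𝟙 X)))) := by
  simp only [cograph_relTensor_δ, δ_relTensor_cograph, cograph_relComp_cograph,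
    graph_hom_eq_cograph_inv]
  congr 1
  ext <;> simp

theorem cograph_mul_comm (X : C) :
    D.relComp (D.graph (swap X X).hom) (D.cograph (lift (𝟙 X) (𝟙 X))) =
      D.cograph (lift (𝟙 X) (𝟙 X)) := by
  rw [graph_hom_eq_cograph_inv, cograph_relComp_cograph]
  congr 1
  ext <;> simp

theorem cograph_mul_tensor (X Y : C) :
    D.cograph (lift (𝟙 (X ⊗ Y)) (𝟙 (X ⊗ Y))) =
      D.relComp (D.graph (middleSwap X Y X Y).hom)
        (D.relTensor (D.cograph (lift (𝟙 X) (𝟙 X))) (D.cograph (lift (𝟙 Y) (𝟙 Y)))) := by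
  rw [cograph_relTensor_cograph, graph_hom_eq_cograph_inv, cograph_relComp_cograph]
  congr 1
  ext <;> simp

theorem cograph_one_tensor (X Y : C) :
    D.cograph (toUnit (X ⊗ Y)) =
      D.relComp (D.graph (λ_ (𝟙_ C)).inv)
        (D.relTensor (D.cograph (toUnit X)) (D.cograph (toUnit Y))) := by
  rw [cograph_relTensor_cograph, ← Iso.symm_hom, graph_hom_eq_cograph_inv,
    cograph_relComp_cograph]
  congr 1
  exact toUnit_unique _ _

theorem cograph_mul_unit : D.cograph (lift (𝟙 (𝟙_ C)) (𝟙 (𝟙_ C))) = D.graph (λ_ (𝟙_ C)).hom := by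
  rw [graph_hom_eq_cograph_inv]
  congr 1
  ext

theorem cograph_one_unit : D.cograph (toUnit (𝟙_ C)) = D.δ (𝟙_ C) := by
  rw [toUnit_unit, cograph_id]

/-! ### Lax homomorphisms, adjointness and the Frobenius laws -/

/-- From `φ(x, y)` and `z = (y, y)`, substitution gives `φ(x, z₁)` and `φ(x, z₂)`. -/
theorem relComp_copy_le (φ : D.P.obj (op (X ⊗ Y))) :
    D.relComp φ (D.graph (lift (𝟙 Y) (𝟙 Y))) ≤
      D.relComp (D.graph (lift (𝟙 X) (𝟙 X))) (D.relTensor φ φ) := by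
  refine le_of_ev_le fun A x z => ev_relComp_le ?_
  simp only [ev_graph_relComp, ev_graph, ev_relTensor, reindex_ev, reindex_inf, ev_δ_tensor,
    Category.assoc, lift_fst, lift_snd, Category.comp_id]
  refine le_inf ?_ ?_
  · exact (inf_le_inf_left _ inf_le_left).trans (D.ev_inf_ev_δ_le_right φ _ _ _)
  · exact (inf_le_inf_left _ inf_le_right).trans (D.ev_inf_ev_δ_le_right φ _ _ _)

theorem graph_toUnit (X : C) : D.graph (toUnit X) = ⊤ :=
  eq_of_ev_eq fun A x y => by rw [ev_graph, ev_δ_unit, ev_top]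

theorem relComp_discard_le (φ : D.P.obj (op (X ⊗ Y))) :
    D.relComp φ (D.graph (toUnit Y)) ≤ D.graph (toUnit X) := by
  rw [graph_toUnit D X]
  exact le_top

theorem copy_relComp_mul (X : C) :
    D.relComp (D.graph (lift (𝟙 X) (𝟙 X))) (D.cograph (lift (𝟙 X) (𝟙 X))) = D.δ X :=
  eq_of_ev_eq fun A x y => by simp [ev_graph_relComp, ev_cograph, ev_δ_tensor]

/-- A graph is left adjoint to its converse. This counit, taken at the diagonal and at `toUnit`,
yields both counit axioms. -/
theorem cograph_relComp_graph_le (f : X ⟶ Y) : D.relComp (D.cograph f) (D.graph f) ≤ D.δ Y := by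
  refine le_of_ev_le fun A y z => ev_relComp_le ?_
  simpa only [ev_cograph, ev_graph, reindex_ev] using D.ev_inf_ev_δ_le_right (D.δ Y) _ _ _

theorem le_graph_relComp_cograph (f : X ⟶ Y) : D.δ X ≤ D.relComp (D.graph f) (D.cograph f) :=
  le_of_ev_le fun A x z => by
    simpa only [ev_graph_relComp, ev_cograph] using D.ev_δ_le_ev_δ_comp f x z

variable {D} in
theorem le_ev_δ_symm {A : C} {κ : D.P.obj (op A)} {x y : A ⟶ X} (h : κ ≤ D.ev (D.δ X) x y) :
    κ ≤ D.ev (D.δ X) y x :=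
  h.trans (D.ev_δ_symm_le x y)

variable {D} in
theorem le_ev_δ_trans {A : C} {κ : D.P.obj (op A)} {x y z : A ⟶ X}
    (h₁ : κ ≤ D.ev (D.δ X) x y) (h₂ : κ ≤ D.ev (D.δ X) y z) : κ ≤ D.ev (D.δ X) x z :=
  (le_inf h₁ h₂).trans (D.ev_inf_ev_δ_le_right (D.δ X) x y z)

/-- At `(x₁, x₂)` and `(z₁, z₂)` the left side says `x₁ = z₁`, `x₁ = z₂`, `x₂ = z₂`, and the right
side has `x₂ = z₁` in place of `x₁ = z₂`. Each says that all four elements are equal. -/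
theorem graph_cograph_frobenius (X : C) :
    D.relComp (D.relTensor (D.graph (lift (𝟙 X) (𝟙 X))) (D.δ X))
        (D.relComp (D.graph (α_ X X X).hom)
          (D.relTensor (D.δ X) (D.cograph (lift (𝟙 X) (𝟙 X))))) =
      D.relComp (D.relTensor (D.δ X) (D.graph (lift (𝟙 X) (𝟙 X))))
        (D.relComp (D.graph (α_ X X X).inv)
          (D.relTensor (D.cograph (lift (𝟙 X) (𝟙 X))) (D.δ X))) := by
  refine eq_of_ev_eq fun A x z => ?_
  simp only [graph_relTensor_δ, δ_relTensor_graph, cograph_relTensor_δ, δ_relTensor_cograph,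
    ev_graph_relComp, ev_cograph]
  simp only [ev_δ_tensor, Category.assoc, whiskerRight_fst, whiskerRight_snd, whiskerLeft_fst,
    whiskerLeft_snd, associator_hom_fst, associator_hom_snd_fst, associator_hom_snd_snd,
    associator_inv_fst_fst, associator_inv_fst_snd, associator_inv_snd,
    whiskerRight_fst_assoc, whiskerLeft_snd_assoc, lift_fst, lift_snd, Category.comp_id]
  apply le_antisymm
  · refine le_inf (le_inf inf_le_left ?_) (inf_le_right.trans inf_le_right)
    exact le_ev_δ_trans (inf_le_right.trans inf_le_right)
      (le_ev_δ_trans (le_ev_δ_symm (inf_le_right.trans inf_le_left)) inf_le_left)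
  · refine le_inf (inf_le_left.trans inf_le_left) (le_inf ?_ inf_le_right)
    exact le_ev_δ_trans (inf_le_left.trans inf_le_left)
      (le_ev_δ_trans (le_ev_δ_symm (inf_le_left.trans inf_le_right)) inf_le_right)

/-! ### Maps -/

theorem relComp_compl_of_isMap {φ : D.P.obj (op (X ⊗ Y))}
    (h₁ : D.relComp (D.graph (lift (𝟙 X) (𝟙 X))) (D.relTensor φ φ) ≤
      D.relComp φ (D.graph (lift (𝟙 Y) (𝟙 Y))))
    (h₂ : D.graph (toUnit X) ≤ D.relComp φ (D.graph (toUnit Y))) (ψ : D.P.obj (op (Y ⊗ Z))) :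
    D.relComp φ ψᶜ = (D.relComp φ ψ)ᶜ := by
  -- `h₁` at `x` and `(y, y')` yields some `w` equal to both `y` and `y'`.
  have functional {A : C} (x : A ⟶ X) (y y' : A ⟶ Y) :
      D.ev φ x y ⊓ D.ev φ x y' ≤ D.ev (D.δ Y) y y' := by
    have h := D.ev_mono h₁ x (lift y y')
    simp only [ev_graph_relComp, ev_relTensor, Category.assoc, lift_fst, lift_snd,
      Category.comp_id] at h
    refine h.trans (ev_relComp_le ?_)
    simp only [ev_graph, ev_δ_tensor, reindex_ev, Category.assoc, lift_fst, lift_snd,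
      Category.comp_id]
    rw [D.ev_δ_comm _ (fst A Y ≫ y)]
    exact inf_le_right.trans (D.ev_inf_ev_δ_le_right (D.δ Y) _ _ _)
  refine eq_of_ev_eq fun A x z => ?_
  rw [ev_compl]
  apply le_antisymm
  · rw [le_compl_iff_disjoint_right, disjoint_iff_inf_le]
    refine inf_ev_relComp_le ?_
    rw [inf_comm, reindex_ev]
    refine inf_ev_relComp_le ?_
    simp only [reindex_ev, reindex_inf, reindex_bot, ev_compl]
    -- The two intermediate elements agree by `functional`, so `ψ` is transported to the one at
    -- which `ψᶜ` holds.
    rw [← inf_compl_eq_bot]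
    refine le_inf (le_trans (le_inf ?_ (inf_le_left.trans inf_le_right))
      (D.ev_inf_ev_δ_le_left ψ _ _ _)) (inf_le_right.trans inf_le_right)
    exact (le_inf (inf_le_right.trans inf_le_left) (inf_le_left.trans inf_le_left)).trans
      (functional _ _ _)
  · have total : ⊤ ≤ D.ev (D.relComp φ (D.graph (toUnit Y))) x (toUnit A) := by
      simpa only [graph_toUnit, ev_top] using D.ev_mono h₂ x (toUnit A)
    -- The goal becomes `⊤ ≤ φ;ψ ⊔ φ;ψᶜ`. Totality supplies an intermediate element, at which either
    -- `ψ` or `ψᶜ` holds.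
    rw [← top_sdiff, sdiff_le_iff]
    refine total.trans (ev_relComp_le ?_)
    refine inf_le_left.trans ?_
    rw [reindex_sup, reindex_ev, reindex_ev]
    calc D.ev φ (fst A Y ≫ x) (snd A Y)
        = D.ev φ (fst A Y ≫ x) (snd A Y) ⊓ D.ev ψ (snd A Y) (fst A Y ≫ z) ⊔
          D.ev φ (fst A Y ≫ x) (snd A Y) ⊓ D.ev ψᶜ (snd A Y) (fst A Y ≫ z) := by
            rw [← inf_sup_left, ev_compl, sup_compl_eq_top, inf_top_eq]
      _ ≤ _ := sup_le_sup (D.ev_inf_ev_le_ev_relComp _ _ _ _ _)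
          (D.ev_inf_ev_le_ev_relComp _ _ _ _ _)

end Structure

/-! ### The bicategory of relations -/

/-- The objects of the bicategory of relations of `D`. -/
def Rel (_ : BooleanHyperdoctrine.{u, v, w} C) : Type u := C

namespace Rel

instance : Category.{w} D.Rel where
  Hom X Y := D.P.obj (op (MonoidalCategoryStruct.tensorObj (C := C) X Y))
  id X := D.δ X
  comp φ ψ := D.relComp φ ψ
  id_comp φ := D.δ_relComp φ
  comp_id φ := D.relComp_δ φ
  assoc φ ψ χ := D.relComp_assoc φ ψ χ

instance (X Y : D.Rel) : BooleanAlgebra (X ⟶ Y) :=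
  (D.P.obj (op (MonoidalCategoryStruct.tensorObj (C := C) X Y))).str

/-- The graph of an isomorphism of `C`. -/
def graphIso {X Y : C} (e : X ≅ Y) : Iso (C := D.Rel) X Y where
  hom := D.graph e.hom
  inv := D.graph e.inv
  hom_inv_id := D.graph_iso_hom_inv e
  inv_hom_id := D.graph_iso_inv_hom e

instance : MonoidalCategoryStruct D.Rel where
  tensorObj X Y := MonoidalCategoryStruct.tensorObj (C := C) X Y
  tensorUnit := 𝟙_ C
  tensorHom φ ψ := D.relTensor φ ψ
  whiskerLeft X _ _ φ := D.relTensor (D.δ X) φ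
  whiskerRight φ X := D.relTensor φ (D.δ X)
  associator X Y Z := graphIso D (MonoidalCategoryStruct.associator (C := C) X Y Z)
  leftUnitor X := graphIso D (MonoidalCategoryStruct.leftUnitor (C := C) X)
  rightUnitor X := graphIso D (MonoidalCategoryStruct.rightUnitor (C := C) X)

instance : MonoidalCategory D.Rel :=
  .ofTensorHom
    (id_tensorHom_id := fun X Y => D.relTensor_δ_δ X Y)
    (id_tensorHom := fun _ _ _ _ => rfl)
    (tensorHom_id := fun _ _ => rfl)
    (tensorHom_comp_tensorHom := fun φ₁ φ₂ ψ₁ ψ₂ => D.relTensor_relComp_relTensor φ₁ φ₂ ψ₁ ψ₂)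
    (associator_naturality := fun φ ψ χ => D.relTensor_relComp_associator φ ψ χ)
    (leftUnitor_naturality := fun φ => D.relTensor_relComp_leftUnitor φ)
    (rightUnitor_naturality := fun φ => D.relTensor_relComp_rightUnitor φ)
    (pentagon := fun W X Y Z => D.graph_pentagon W X Y Z)
    (triangle := fun X Y => D.graph_triangle X Y)

instance : SymmetricCategory D.Rel where
  braiding X Y := graphIso D (swap (C := C) X Y)
  braiding_naturality_right X _ _ φ := D.relTensor_relComp_swap (D.δ X) φ
  braiding_naturality_left φ Z := D.relTensor_relComp_swap φ (D.δ Z)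
  hexagon_forward X Y Z := D.graph_hexagon_forward X Y Z
  hexagon_reverse X Y Z := D.graph_hexagon_reverse X Y Z
  symmetry X Y := D.graph_iso_hom_inv (swap (C := C) X Y)

theorem tensorμ_eq (X Y U V : C) :
    tensorμ (C := D.Rel) X Y U V = D.graph (middleSwap X Y U V).hom :=
  D.graph_middleSwap X Y U V

instance (X : D.Rel) : ComonObj X where
  counit := D.graph (toUnit (C := C) X)
  comul := D.graph
    (CartesianMonoidalCategory.lift (CategoryStruct.id (obj := C) X) (CategoryStruct.id (obj := C) X))
  counit_comul := D.graph_counit_comul X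
  comul_counit := D.graph_comul_counit X
  comul_assoc := D.graph_comul_assoc X

instance (X : D.Rel) : MonObj X where
  one := D.cograph (toUnit (C := C) X)
  mul := D.cograph
    (CartesianMonoidalCategory.lift (CategoryStruct.id (obj := C) X) (CategoryStruct.id (obj := C) X))
  one_mul := D.cograph_one_mul X
  mul_one := D.cograph_mul_one X
  mul_assoc := D.cograph_mul_assoc X

instance : CopyDiscardCategory D.Rel where
  isCommComonObj X := { comul_comm := D.graph_comul_comm X }
  copy_tensor X Y :=
    (D.graph_copy_tensor X Y).trans (congrArg (D.relComp _) (tensorμ_eq D X X Y Y).symm)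
  discard_tensor X Y := D.graph_discard_tensor X Y
  copy_unit := D.graph_copy_unit
  discard_unit := D.graph_discard_unit

instance : CartesianBicategory D.Rel where
  comp_mono h₁ h₂ := relComp_mono (D := D) h₁ h₂
  tensor_mono h₁ h₂ := relTensor_mono (D := D) h₁ h₂
  isCommMonObj X := { mul_comm := D.cograph_mul_comm X }
  mul_tensor X Y :=
    (D.cograph_mul_tensor X Y).trans
      (congrArg (fun φ => D.relComp φ (D.relTensor _ _)) (tensorμ_eq D X Y X Y).symm)
  one_tensor X Y := D.cograph_one_tensor X Y
  mul_unit := D.cograph_mul_unit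
  one_unit := D.cograph_one_unit
  copy_lax φ := D.relComp_copy_le φ
  discard_lax φ := D.relComp_discard_le φ
  copy_unit_le X := (D.copy_relComp_mul X).ge
  copy_counit_le _ := D.cograph_relComp_graph_le _
  discard_unit_le _ := D.le_graph_relComp_cograph _
  discard_counit_le _ := D.cograph_relComp_graph_le _
  special X := D.copy_relComp_mul X
  frobenius X := D.graph_cograph_frobenius X

end Rel

/-- The bicategory of relations of a boolean hyperdoctrine. -/
def peirceanRel : PeirceanBicategory.{u, w} where
  Obj := D.Rel
  map_comp_compl _ ψ h := D.relComp_compl_of_isMap h.1 h.2 ψ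

end BooleanHyperdoctrine

theorem mainTheorem6 {C : Type u} [Category.{v} C] [CartesianMonoidalCategory C]
    (D : BooleanHyperdoctrine.{u, v, w} C) :
    D.rel.IsPeirceanBicategory :=
  -- Each operation of `peirceanRel` is by definition the corresponding field of `rel`.
  ⟨D.peirceanRel, rfl⟩
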